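/- Let $G$ be a finite group. For a subgroup $H$ of a group $U$, put $P_U(H)=\langle\, x\in U \mid \langle x\rangle H=H\langle x\rangle \,\rangle$ (the permutizer of $H$ in $U$). A subgroup $H\le G$ is called strongly permutable in $G$ if $P_U(H)=U$ for every subgroup $U$ of $G$ with $H\le U\le G$. If every cyclic subgroup of prime power order of $G$ is strongly permutable in $G$, then $G$ is supersoluble, i.e. there is a series $1=N_0\le N_1\le\dots\le N_n=G$ of normal subgroups of $G$ such that every factor $N_{i+1}/N_i$ is cyclic. -/

import Mathlib

open scoped Pointwise

namespace FiniteGroup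

variable {G : Type*} [Group G]

/-- The permutizer `P_G(H) = ⟨x ∈ G ∣ ⟨x⟩H = H⟨x⟩⟩` of a subgroup `H` in the group `G`;
the products are products of subsets of `G`. -/
def permutizer (H : Subgroup G) : Subgroup G :=
  Subgroup.closure {x : G | (Subgroup.zpowers x : Set G) * (H : Set G) =
    (H : Set G) * (Subgroup.zpowers x : Set G)}

/-- `H` is permutable in `G` if `P_G(H) = G`. -/
def IsPermutable (H : Subgroup G) : Prop :=
  permutizer H = ⊤

/-- `H` is strongly permutable in `G` if `P_U(H) = U` for every subgroup `U` of `G` with `H ≤ U`,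
i.e. `H`, regarded as a subgroup of the group `U`, is permutable in `U`. -/
def IsStronglyPermutable (H : Subgroup G) : Prop :=
  ∀ U : Subgroup G, H ≤ U → IsPermutable (H.subgroupOf U)

/-- A primary cyclic subgroup: a cyclic subgroup of prime power order. -/
def IsPrimaryCyclic (H : Subgroup G) : Prop :=
  IsCyclic H ∧ ∃ p k : ℕ, p.Prime ∧ Nat.card H = p ^ k

/-- `G` is supersoluble: there is a series `1 = N₀ ≤ N₁ ≤ ⋯ ≤ Nₙ = G` of subgroups that are all
normal in `G`, with every factor `Nᵢ₊₁ / Nᵢ` (a subgroup of `G / Nᵢ`) cyclic. -/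
def IsSupersoluble (G : Type*) [Group G] : Prop :=
  ∃ (n : ℕ) (N : ℕ → Subgroup G) (_ : ∀ i, (N i).Normal),
    N 0 = ⊥ ∧ N n = ⊤ ∧
      ∀ i < n, N i ≤ N (i + 1) ∧ IsCyclic ((N (i + 1)).map (QuotientGroup.mk' (N i)))

end FiniteGroup

open scoped Pointwise commutatorElement

universe u

/-! Induction on |G|. The hypothesis, put into the elementwise form below, passes to subgroups and
quotients. Let p be the largest prime divisor of |G|. A Sylow p-subgroup is normal (`sylow_normal`),
hence contains an elementary abelian minimal normal subgroup N of G. By induction G/N is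
supersoluble, and it remains to see that N is cyclic.

Normality. By induction proper subgroups have a normal Sylow p-subgroup, and one may assume that G
has no nontrivial normal p-subgroup; then distinct Sylow p-subgroups meet trivially. Let a have
order p and let ⟨y⟩ permute with ⟨a⟩. If ⟨y⟩⟨a⟩ is proper, y normalizes the Sylow subgroup
containing a. The case G = ⟨y⟩⟨a⟩ is excluded by Itô's theorem and the maximality of p. Such y
generate G, so the Sylow subgroup is normal after all.

Cyclicity. View N as an irreducible F_p[G]-module V. Permutability of the subgroups ⟨v⟩ forces (g -
1)(g - l) = 0 for each g acting with prime power order. If not all of G acted by scalars,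
supersolubility of G/N would give a nonscalar b of prime power order generating a normal subgroup
modulo scalars. Then G permutes the two eigenspaces of b, and the quadratic relations for an r
swapping them, for the commutator of b and r, and for rb contradict each other
(`exists_scalar_of_quadratic`). So every line of V is invariant and V is a line. -/

/-- Every cyclic subgroup `⟨a⟩` of prime power order is permutable in each subgroup `U` of `G`
containing it; all subgroups and products are taken inside `G`. -/
def HasPermutablePrimaryElements (G : Type*) [Group G] : Prop :=
  ∀ (a : G) (p k : ℕ), p.Prime → orderOf a = p ^ k → ∀ U : Subgroup G, a ∈ U →
    U ≤ Subgroup.closure {x : G | x ∈ U ∧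
      (Subgroup.zpowers x : Set G) * (Subgroup.zpowers a : Set G) =
        (Subgroup.zpowers a : Set G) * (Subgroup.zpowers x : Set G)}

/-! ### Inheritance by subgroups and quotients -/

theorem image_zpowers_mul_zpowers {G Q : Type*} [Group G] [Group Q] (f : G →* Q) (x a : G) :
    f '' ((Subgroup.zpowers x : Set G) * (Subgroup.zpowers a : Set G)) =
      (Subgroup.zpowers (f x) : Set Q) * (Subgroup.zpowers (f a) : Set Q) := by
  rw [Set.image_mul, ← Subgroup.coe_map, ← Subgroup.coe_map, MonoidHom.map_zpowers,
    MonoidHom.map_zpowers]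

theorem zpowers_mul_comm_map {G Q : Type*} [Group G] [Group Q] (f : G →* Q) {x a : G}
    (h : (Subgroup.zpowers x : Set G) * (Subgroup.zpowers a : Set G) =
      (Subgroup.zpowers a : Set G) * (Subgroup.zpowers x : Set G)) :
    (Subgroup.zpowers (f x) : Set Q) * (Subgroup.zpowers (f a) : Set Q) =
      (Subgroup.zpowers (f a) : Set Q) * (Subgroup.zpowers (f x) : Set Q) := by
  rw [← image_zpowers_mul_zpowers, ← image_zpowers_mul_zpowers, h]

theorem zpowers_mul_comm_of_map {G Q : Type*} [Group G] [Group Q] (f : G →* Q)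
    (hf : Function.Injective f) {x a : G}
    (h : (Subgroup.zpowers (f x) : Set Q) * (Subgroup.zpowers (f a) : Set Q) =
      (Subgroup.zpowers (f a) : Set Q) * (Subgroup.zpowers (f x) : Set Q)) :
    (Subgroup.zpowers x : Set G) * (Subgroup.zpowers a : Set G) =
      (Subgroup.zpowers a : Set G) * (Subgroup.zpowers x : Set G) := by
  rw [← image_zpowers_mul_zpowers, ← image_zpowers_mul_zpowers] at h
  exact hf.image_injective h

theorem HasPermutablePrimaryElements.subgroup {G : Type*} [Group G]
    (hG : HasPermutablePrimaryElements G) (K : Subgroup G) : HasPermutablePrimaryElements K := by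
  intro a p k hp ha U haU
  have h := hG (a : G) p k hp (by rw [Subgroup.orderOf_coe, ha]) (U.map K.subtype)
    (Subgroup.mem_map_of_mem K.subtype haU)
  rw [← Subgroup.map_le_map_iff_of_injective K.subtype_injective, MonoidHom.map_closure]
  refine h.trans (Subgroup.closure_mono ?_)
  rintro _ ⟨⟨x, hx, rfl⟩, hxa⟩
  exact ⟨x, ⟨hx, zpowers_mul_comm_of_map K.subtype K.subtype_injective hxa⟩, rfl⟩

/-- Raising any preimage to the p'-part m of its order gives a p-element. As m is coprime to the
order of the image, a further power restores the image. -/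
theorem exists_primary_lift {G Q : Type*} [Group G] [Finite G] [Group Q] {f : G →* Q}
    (hf : Function.Surjective f) {b : Q} {p k : ℕ} (hp : p.Prime) (hb : orderOf b = p ^ k) :
    ∃ (a : G) (j : ℕ), f a = b ∧ orderOf a = p ^ j := by
  obtain ⟨g, rfl⟩ := hf b
  obtain ⟨j, m, hm, hgm⟩ := Nat.exists_eq_pow_mul_and_not_dvd (orderOf_pos g).ne' p hp.ne_one
  have hco : m.Coprime (orderOf (f g)) := by
    rw [hb]
    exact Nat.Coprime.pow_right _ ((Nat.Prime.coprime_iff_not_dvd hp).2 hm).symm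
  obtain ⟨s, hs⟩ := exists_pow_eq_self_of_coprime hco
  have h1 : ((g ^ m) ^ s) ^ p ^ j = 1 := by
    rw [← pow_mul, ← pow_mul, show m * (s * p ^ j) = (p ^ j * m) * s by ring, ← hgm, pow_mul,
      pow_orderOf_eq_one, one_pow]
  obtain ⟨i, -, hi⟩ := (Nat.dvd_prime_pow hp).1 (orderOf_dvd_of_pow_eq_one h1)
  exact ⟨(g ^ m) ^ s, i, by rw [map_pow, map_pow, hs], hi⟩

theorem HasPermutablePrimaryElements.of_surjective {G Q : Type*} [Group G] [Finite G] [Group Q]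
    (hG : HasPermutablePrimaryElements G) {f : G →* Q} (hf : Function.Surjective f) :
    HasPermutablePrimaryElements Q := by
  intro b p k hp hb U hbU
  obtain ⟨a, j, rfl, ha⟩ := exists_primary_lift hf hp hb
  have h := hG a p j hp ha (U.comap f) hbU
  have h' := Subgroup.map_mono (f := f) h
  rw [Subgroup.map_comap_eq_self_of_surjective hf, MonoidHom.map_closure] at h'
  refine h'.trans (Subgroup.closure_mono ?_)
  rintro _ ⟨x, ⟨hx, hxa⟩, rfl⟩
  exact ⟨hx, zpowers_mul_comm_map f hxa⟩

/-- An element of finite order lies in a subgroup as soon as all of its powers of prime power order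
do. -/
theorem Subgroup.mem_of_primary_powers_mem {G : Type*} [Group G] [Finite G] (S : Subgroup G) (x : G)
    (h : ∀ m p k : ℕ, p.Prime → orderOf (x ^ m) = p ^ k → x ^ m ∈ S) : x ∈ S := by
  suffices H : ∀ n : ℕ, ∀ x : G, orderOf x = n →
      (∀ m p k : ℕ, p.Prime → orderOf (x ^ m) = p ^ k → x ^ m ∈ S) → x ∈ S from H _ x rfl h
  intro n
  induction n using Nat.recOnPosPrimePosCoprime with
  | prime_pow p k hp hk =>
    intro x hx h
    simpa using h 1 p k hp (by simpa using hx)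
  | zero => intro x hx; exact absurd hx (orderOf_pos x).ne'
  | one => intro x hx _; rw [orderOf_eq_one_iff.1 hx]; exact S.one_mem
  | coprime a b ha hb hab iha ihb =>
    intro x hx h
    have h1 : x ^ a ∈ S := ihb _ (by
      rw [orderOf_pow_of_dvd (by omega) (hx ▸ Dvd.intro _ rfl), hx]
      exact Nat.mul_div_cancel_left _ (by omega))
      (fun m p k hp hm => by rw [← pow_mul] at hm ⊢; exact h _ p k hp hm)
    have h2 : x ^ b ∈ S := iha _ (by
      rw [orderOf_pow_of_dvd (by omega) (hx ▸ Dvd.intro_left _ rfl), hx]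
      exact Nat.mul_div_cancel _ (by omega))
      (fun m p k hp hm => by rw [← pow_mul] at hm ⊢; exact h _ p k hp hm)
    have h3 : x = (x ^ a) ^ (a.gcdA b) * (x ^ b) ^ (a.gcdB b) := by
      have := Nat.gcd_eq_gcd_ab a b
      rw [hab.gcd_eq_one] at this
      rw [← zpow_natCast, ← zpow_natCast, ← zpow_mul, ← zpow_mul, ← zpow_add, ← this]
      simp
    rw [h3]
    exact S.mul_mem (S.zpow_mem h1 _) (S.zpow_mem h2 _)

theorem hasPermutablePrimaryElements_of_isStronglyPermutable {G : Type*} [Group G]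
    (h : ∀ H : Subgroup G,
      FiniteGroup.IsPrimaryCyclic H → FiniteGroup.IsStronglyPermutable H) :
    HasPermutablePrimaryElements G := by
  intro a p k hp ha U haU
  have hle : Subgroup.zpowers a ≤ U := by simpa using haU
  have h1 := h (Subgroup.zpowers a) ⟨inferInstance, p, k, hp, by rw [Nat.card_zpowers, ha]⟩ U hle
  unfold FiniteGroup.IsPermutable FiniteGroup.permutizer at h1
  have hz : (Subgroup.zpowers a).subgroupOf U = Subgroup.zpowers (⟨a, haU⟩ : U) := by
    apply Subgroup.map_injective U.subtype_injective
    rw [Subgroup.map_subgroupOf_eq_of_le hle, MonoidHom.map_zpowers]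
    rfl
  rw [hz] at h1
  have h2 := congrArg (Subgroup.map U.subtype) h1
  rw [MonoidHom.map_closure, ← MonoidHom.range_eq_map, Subgroup.range_subtype] at h2
  refine h2.ge.trans (Subgroup.closure_mono ?_)
  rintro _ ⟨x, hx, rfl⟩
  exact ⟨x.2, zpowers_mul_comm_map U.subtype hx⟩

/-! ### Products of two cyclic subgroups -/

/-- Itô: a product of two abelian subgroups is metabelian. -/
theorem mul_comm_of_mem_commutator_of_factorization {G : Type*} [Group G] {A B : Subgroup G}
    (hA : ∀ x ∈ A, ∀ y ∈ A, x * y = y * x) (hB : ∀ x ∈ B, ∀ y ∈ B, x * y = y * x)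
    (hAB : ∀ g : G, ∃ a ∈ A, ∃ b ∈ B, g = a * b) :
    ∀ x ∈ commutator G, ∀ y ∈ commutator G, x * y = y * x := by
  have hBA : ∀ g : G, ∃ b ∈ B, ∃ a ∈ A, g = b * a := by
    intro g
    obtain ⟨a, ha, b, hb, h⟩ := hAB g⁻¹
    exact ⟨b⁻¹, B.inv_mem hb, a⁻¹, A.inv_mem ha, by rw [← mul_inv_rev, ← h, inv_inv]⟩
  have key : ∀ a ∈ A, ∀ b ∈ B, ∀ a' ∈ A, ∀ b' ∈ B, ⁅a, b⁆ * ⁅a', b'⁆ = ⁅a', b'⁆ * ⁅a, b⁆ := by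
    intro a ha b hb a' ha' b' hb'
    obtain ⟨b₂, hb₂, a₂, ha₂, h₂⟩ := hBA (a'⁻¹ * b * a')
    obtain ⟨a₃, ha₃, b₃, hb₃, h₃⟩ := hAB (b'⁻¹ * a * b')
    have e₁ : ∀ u ∈ A, a'⁻¹ * ⁅u, b⁆ * a' = ⁅u, b₂⁆ := by
      intro u hu
      have h : a'⁻¹ * u * a' = u := by rw [mul_assoc, hA u hu a' ha']; group
      calc a'⁻¹ * ⁅u, b⁆ * a' = ⁅a'⁻¹ * u * a', a'⁻¹ * b * a'⁆ := by
            simp only [commutatorElement_def]; group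
        _ = b₂⁻¹⁻¹ * (b₂⁻¹ * u * b₂ * (a₂ * u⁻¹ * a₂⁻¹)) * b₂⁻¹ := by
            rw [h, h₂, commutatorElement_def]; group
        _ = ⁅u, b₂⁆ := by
            rw [hA a₂ ha₂ u⁻¹ (A.inv_mem hu), commutatorElement_def]; group
    have e₂ : ∀ v ∈ B, b'⁻¹ * ⁅a, v⁆ * b' = ⁅a₃, v⁆ := by
      intro v hv
      have h : b'⁻¹ * v * b' = v := by rw [mul_assoc, hB v hv b' hb']; group
      calc b'⁻¹ * ⁅a, v⁆ * b' = ⁅b'⁻¹ * a * b', b'⁻¹ * v * b'⁆ := by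
            simp only [commutatorElement_def]; group
        _ = a₃ * (b₃ * v * b₃⁻¹) * a₃⁻¹ * v⁻¹ := by
            rw [h, h₃, commutatorElement_def]; group
        _ = ⁅a₃, v⁆ := by
            rw [hB b₃ hb₃ v hv, commutatorElement_def]; group
    -- Conjugation by a' changes only the B-entry of the commutator and conjugation by b' only the
    -- A-entry, so the two conjugations commute on ⁅a, b⁆.
    have e : a'⁻¹ * (b'⁻¹ * ⁅a, b⁆ * b') * a' = b'⁻¹ * (a'⁻¹ * ⁅a, b⁆ * a') * b' := by
      rw [e₂ b hb, e₁ a₃ ha₃, e₁ a ha, e₂ b₂ hb₂]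
    calc ⁅a, b⁆ * ⁅a', b'⁆
        = a' * b' * (b'⁻¹ * (a'⁻¹ * ⁅a, b⁆ * a') * b') * a'⁻¹ * b'⁻¹ := by
          simp only [commutatorElement_def]; group
      _ = ⁅a', b'⁆ * ⁅a, b⁆ := by
          rw [← e]; simp only [commutatorElement_def]; group
  have hcomm : ∀ x ∈ ⁅A, B⁆, ∀ y ∈ ⁅A, B⁆, x * y = y * x := by
    intro x hx y hy
    rw [Subgroup.commutator_def] at hx hy
    have hle : Subgroup.closure {g | ∃ g₁ ∈ A, ∃ g₂ ∈ B, ⁅g₁, g₂⁆ = g} ≤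
        Subgroup.centralizer (Subgroup.closure {g | ∃ g₁ ∈ A, ∃ g₂ ∈ B, ⁅g₁, g₂⁆ = g} : Set G) := by
      rw [Subgroup.centralizer_closure, Subgroup.closure_le]
      rintro _ ⟨a, ha, b, hb, rfl⟩
      simp only [SetLike.mem_coe, Subgroup.mem_centralizer_iff]
      rintro _ ⟨a', ha', b', hb', rfl⟩
      exact (key a ha b hb a' ha' b' hb').symm
    exact ((Subgroup.mem_centralizer_iff.1 (hle hx)) y hy).symm
  have hnorm : (⁅A, B⁆ : Subgroup G).Normal := by
    rw [← Subgroup.normalizer_eq_top_iff, eq_top_iff]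
    intro g _
    obtain ⟨a, ha, b, hb, rfl⟩ := hAB g
    exact mul_mem (Subgroup.normalizer_commutator_ge_left A B ha)
      (Subgroup.normalizer_commutator_ge_right A B hb)
  have hle : commutator G ≤ ⁅A, B⁆ := by
    rw [← Subgroup.Normal.quotient_commutative_iff_commutator_le]
    refine ⟨⟨?_⟩⟩
    have hc : ∀ a ∈ A, ∀ b ∈ B, Commute (a : G ⧸ ⁅A, B⁆) (b : G ⧸ ⁅A, B⁆) := by
      intro a ha b hb
      rw [← commutatorElement_eq_one_iff_commute]
      have := (QuotientGroup.eq_one_iff (N := ⁅A, B⁆) ⁅a, b⁆).2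
        (Subgroup.commutator_mem_commutator ha hb)
      rwa [← QuotientGroup.mk'_apply, map_commutatorElement] at this
    intro x y
    induction x using QuotientGroup.induction_on with | H x => ?_
    induction y using QuotientGroup.induction_on with | H y => ?_
    obtain ⟨a, ha, b, hb, rfl⟩ := hAB x
    obtain ⟨a', ha', b', hb', rfl⟩ := hAB y
    have h1 : Commute (a : G ⧸ ⁅A, B⁆) a' := congrArg (QuotientGroup.mk' ⁅A, B⁆) (hA a ha a' ha')
    have h2 : Commute (b : G ⧸ ⁅A, B⁆) b' := congrArg (QuotientGroup.mk' ⁅A, B⁆) (hB b hb b' hb')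
    exact ((h1.mul_right (hc a ha b' hb')).mul_left ((hc a' ha' b hb).symm.mul_right h2)).eq
  exact fun x hx y hy => hcomm x (hle hx) y (hle hy)

/-- A prime factor of φ(n) divides n or some q - 1 with q a prime factor of n, and q - 1 < p. -/
theorem Nat.not_dvd_totient_of_forall_prime_le {p n : ℕ} (hp : p.Prime)
    (hpn : ¬ p ∣ n) (hmax : ∀ q : ℕ, q.Prime → q ∣ n → q ≤ p) : ¬ p ∣ n.totient := by
  intro h
  have h1 : p ∣ n * ∏ q ∈ n.primeFactors, (q - 1) := by
    rw [← Nat.totient_mul_prod_primeFactors]; exact h.mul_right _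
  rcases hp.dvd_mul.1 h1 with h2 | h2
  · exact hpn h2
  · obtain ⟨q, hq, hpq⟩ := (Nat.Prime.prime hp).exists_mem_finset_dvd h2
    have hqp := Nat.prime_of_mem_primeFactors hq
    have := hmax q hqp (Nat.dvd_of_mem_primeFactors hq)
    have := Nat.le_of_dvd (by have := hqp.two_le; omega) hpq
    have := hqp.two_le
    omega

/-- A Sylow p-subgroup of the abelian group N is characteristic in N, hence normal in G. -/
theorem Subgroup.not_dvd_card_of_mul_comm {G : Type*} [Group G] [Finite G] {p : ℕ} (hp : p.Prime)
    (hno : ∀ T : Subgroup G, T.Normal → IsPGroup p T → T = ⊥) (N : Subgroup G) (hN : N.Normal)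
    (hc : ∀ x ∈ N, ∀ y ∈ N, x * y = y * x) : ¬ p ∣ Nat.card N := by
  intro hdvd
  have := Fact.mk hp
  obtain ⟨P⟩ := (inferInstance : Nonempty (Sylow p N))
  have hPn : (P : Subgroup N).Normal := ⟨fun x hx g => by
    have : g * x = x * g := Subtype.ext (hc g g.2 x x.2)
    rwa [this, mul_inv_cancel_right]⟩
  have := P.characteristic_of_normal hPn
  have h1 : ((P : Subgroup N).map N.subtype).Normal := inferInstance
  have h2 := hno _ h1 (P.isPGroup'.map _)
  rw [Subgroup.map_eq_bot_iff_of_injective _ N.subtype_injective] at h2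
  exact P.ne_bot_of_dvd_card hdvd h2

/-- Otherwise G' is abelian by Itô, hence a p'-group. Since ⟨y⟩ has index 1 or p, it contains G' and
so is a normal p'-group. By maximality of p no automorphism of ⟨y⟩ has order p, so h centralizes ⟨y⟩
and ⟨h⟩ is normal. -/
theorem exists_normal_pgroup_of_factorization {G : Type*} [Group G] [Finite G] {p : ℕ}
    (hp : p.Prime) (hmax : ∀ q : ℕ, q.Prime → q ∣ Nat.card G → q ≤ p) {y h : G}
    (hh : orderOf h = p)
    (hfac : ∀ g : G, ∃ a ∈ Subgroup.zpowers y, ∃ b ∈ Subgroup.zpowers h, g = a * b) :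
    ∃ T : Subgroup G, T.Normal ∧ IsPGroup p T ∧ T ≠ ⊥ := by
  by_contra! hno
  have hcz : ∀ z : G, ∀ u ∈ Subgroup.zpowers z, ∀ v ∈ Subgroup.zpowers z, u * v = v * u := by
    rintro z _ ⟨i, rfl⟩ _ ⟨j, rfl⟩
    exact ((Commute.refl z).zpow_zpow i j).eq
  have hD := mul_comm_of_mem_commutator_of_factorization (hcz y) (hcz h) hfac
  have hDp := Subgroup.not_dvd_card_of_mul_comm hp hno (commutator G) inferInstance hD
  set C := Subgroup.zpowers y with hC
  have hindex : C.index ∣ p := by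
    have htrans : MulAction.IsPretransitive (Subgroup.zpowers h) (G ⧸ C) := by
      have h0 : ∀ x : G ⧸ C, ∃ b : Subgroup.zpowers h, b • ((1 : G) : G ⧸ C) = x := by
        intro x
        induction x using QuotientGroup.induction_on with | H x => ?_
        obtain ⟨a, ha, b, hb, hx⟩ := hfac x⁻¹
        refine ⟨⟨b⁻¹, inv_mem hb⟩, ?_⟩
        change ((b⁻¹ * 1 : G) : G ⧸ C) = x
        rw [QuotientGroup.eq]
        have : x = b⁻¹ * a⁻¹ := by rw [← mul_inv_rev, ← hx, inv_inv]
        rw [this]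
        simpa using ha
      refine ⟨fun u v => ?_⟩
      obtain ⟨b, rfl⟩ := h0 u
      obtain ⟨c, rfl⟩ := h0 v
      exact ⟨c * b⁻¹, by rw [mul_smul, inv_smul_smul]⟩
    have h1 := MulAction.index_stabilizer_of_transitive (Subgroup.zpowers h) ((1 : G) : G ⧸ C)
    rw [Subgroup.index, ← h1, ← hh, ← Nat.card_zpowers]
    exact Subgroup.index_dvd_card _
  have hDC : commutator G ≤ C := by
    -- Both sides equal |C G'|. If C had index p in C G', then p would divide |G'|.
    have h1 : (commutator G).relIndex C * Nat.card (commutator G) =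
        C.relIndex (C ⊔ commutator G) * Nat.card C := by
      rw [← Subgroup.relIndex_sup_right, ← Subgroup.relIndex_bot_left,
        ← Subgroup.relIndex_bot_left, mul_comm, mul_comm (C.relIndex _),
        Subgroup.relIndex_mul_relIndex _ _ _ bot_le le_sup_right,
        Subgroup.relIndex_mul_relIndex _ _ _ bot_le le_sup_left]
    rcases (Nat.dvd_prime hp).1 ((Subgroup.relIndex_dvd_index_of_le le_sup_left).trans hindex)
      with h2 | h2
    · exact le_sup_right.trans (Subgroup.relIndex_eq_one.1 h2)
    · obtain ⟨t, ht⟩ := Subgroup.relIndex_dvd_card (commutator G) C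
      have hpos : 0 < (commutator G).relIndex C := Nat.pos_of_ne_zero fun h0 => by
        rw [h0, zero_mul] at ht
        exact Nat.card_pos.ne' ht
      refine absurd ⟨t, Nat.eq_of_mul_eq_mul_left hpos ?_⟩ hDp
      rw [h1, h2, ht]
      ring
  have hCn : C.Normal := Subgroup.Normal.of_commutator_le _ hDC
  have hCp := Subgroup.not_dvd_card_of_mul_comm hp hno C hCn (hcz y)
  have hθ : MulAut.conjNormal (H := C) h = 1 := by
    have h1 : orderOf (MulAut.conjNormal (H := C) h) ∣ p := hh ▸ orderOf_map_dvd _ h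
    rcases (Nat.dvd_prime hp).1 h1 with h2 | h2
    · exact orderOf_eq_one_iff.1 h2
    · exfalso
      have h3 : p ∣ Nat.card (MulAut C) := h2 ▸ orderOf_dvd_natCard _
      rw [IsCyclic.card_mulAut] at h3
      exact Nat.not_dvd_totient_of_forall_prime_le hp hCp
        (fun q hq hqC => hmax q hq (hqC.trans (Subgroup.card_subgroup_dvd_card C))) h3
  have hcomm : ∀ c ∈ C, h * c = c * h := by
    intro c hc
    have := congrArg Subtype.val (DFunLike.congr_fun hθ (⟨c, hc⟩ : C))
    rw [MulAut.conjNormal_apply] at this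
    exact mul_inv_eq_iff_eq_mul.1 this
  have hHn : (Subgroup.zpowers h).Normal := by
    refine ⟨fun n hn g => ?_⟩
    have h1 : Commute g n := by
      obtain ⟨a, ha, b, hb, rfl⟩ := hfac g
      obtain ⟨j, rfl⟩ := hn
      exact Commute.mul_left (Commute.zpow_right (hcomm a ha).symm j) (hcz h b hb _ ⟨j, rfl⟩)
    rwa [h1.eq, mul_inv_cancel_right]
  have := hno _ hHn (IsPGroup.of_card (n := 1) (by rw [Nat.card_zpowers, hh, pow_one]))
  rw [Subgroup.zpowers_eq_bot] at this
  rw [this, orderOf_one] at hh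
  exact hp.one_lt.ne hh

theorem Subgroup.mem_mul_of_mem_sup {G : Type*} [Group G] {A B : Subgroup G}
    (h : (A : Set G) * (B : Set G) = (B : Set G) * (A : Set G)) {g : G} (hg : g ∈ A ⊔ B) :
    ∃ a ∈ A, ∃ b ∈ B, g = a * b := by
  suffices g ∈ (A : Set G) * (B : Set G) by
    obtain ⟨a, ha, b, hb, rfl⟩ := Set.mem_mul.1 this
    exact ⟨a, ha, b, hb, rfl⟩
  rw [Subgroup.sup_eq_closure_mul] at hg
  induction hg using Subgroup.closure_induction with
  | mem x hx => exact hx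
  | one => exact Set.mem_mul.2 ⟨1, A.one_mem, 1, B.one_mem, mul_one 1⟩
  | mul x y _ _ hx hy =>
    have h1 := Set.mul_mem_mul hx hy
    rwa [mul_assoc, ← mul_assoc (B : Set G), ← h, mul_assoc (A : Set G), coe_mul_coe B, ← mul_assoc,
      coe_mul_coe A] at h1
  | inv x _ hx =>
    have := Set.inv_mem_inv.2 hx
    rwa [mul_inv_rev, inv_coe_set, inv_coe_set, ← h] at this

/-! ### The Sylow subgroup for the largest prime -/

theorem Subgroup.lt_inf_normalizer_of_lt {G : Type*} [Group G] [Finite G] {p : ℕ} [Fact p.Prime]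
    {D P : Subgroup G} (hP : IsPGroup p P) (h : D < P) :
    D < P ⊓ Subgroup.normalizer (D : Set G) := by
  have := hP.isNilpotent
  have h1 : D.subgroupOf P < ⊤ := by
    rw [lt_top_iff_ne_top, Ne, Subgroup.subgroupOf_eq_top]
    exact h.not_ge
  have h2 := Group.normalizerCondition_of_isNilpotent _ h1
  rw [← Subgroup.subgroupOf_normalizer_eq h.le] at h2
  refine lt_of_le_of_ne (le_inf h.le Subgroup.le_normalizer) fun h3 => h2.ne ?_
  conv_lhs => rw [h3]
  rw [Subgroup.inf_subgroupOf_left]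

/-- If every proper subgroup of `G` has a largest `p`-subgroup and `G` has no nontrivial normal
`p`-subgroup, then distinct Sylow `p`-subgroups of `G` intersect trivially. -/
theorem Sylow.eq_of_inf_ne_bot {G : Type*} [Group G] [Finite G] {p : ℕ} [Fact p.Prime]
    (hno : ∀ T : Subgroup G, T.Normal → IsPGroup p T → T = ⊥)
    (hsub : ∀ K : Subgroup G, K ≠ ⊤ → ∃ T : Subgroup G, IsPGroup p T ∧
      ∀ S ≤ K, IsPGroup p S → S ≤ T) (P Q : Sylow p G)
    (hPQ : (P : Subgroup G) ⊓ Q ≠ ⊥) : P = Q := by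
  induction hD : (P : Subgroup G) ⊓ Q using WellFoundedGT.induction generalizing P Q with
  | ind D ih =>
    subst hD
    by_contra hne
    obtain ⟨T, hTp, hT⟩ := hsub (Subgroup.normalizer (((P : Subgroup G) ⊓ Q : Subgroup G) : Set G))
      fun h => hPQ (hno _ (Subgroup.normalizer_eq_top_iff.1 h) P.2.to_inf_left)
    obtain ⟨R, hR⟩ := hTp.exists_le_sylow
    -- Normalizers grow in p-groups, so P and Q both meet R in more than P ∩ Q; induction on larger
    -- intersections makes both equal to R.
    have key : ∀ S : Sylow p G, (P : Subgroup G) ⊓ Q < S → S = R := by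
      intro S hS
      have h1 := Subgroup.lt_inf_normalizer_of_lt S.2 hS
      have h2 : (P : Subgroup G) ⊓ Q < (S : Subgroup G) ⊓ R :=
        h1.trans_le (le_inf inf_le_left ((hT _ inf_le_right S.2.to_inf_left).trans hR))
      exact ih _ h2 S R (bot_le.trans_lt h2).ne' rfl
    have h1 : (P : Subgroup G) ⊓ Q < P := lt_of_le_of_ne inf_le_left fun h =>
      hne (Sylow.ext (P.3 Q.2 (inf_eq_left.1 h)).symm)
    have h2 : (P : Subgroup G) ⊓ Q < Q := lt_of_le_of_ne inf_le_right fun h =>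
      hne (Sylow.ext (Q.3 P.2 (inf_eq_right.1 h)))
    exact hne ((key P h1).trans (key Q h2).symm)

theorem Subgroup.exists_largest_pgroup_of_sylow_normal {G : Type*} [Group G] [Finite G] {p : ℕ}
    [Fact p.Prime] {K : Subgroup G} (h : ∀ P : Sylow p K, (P : Subgroup K).Normal) :
    ∃ T : Subgroup G, IsPGroup p T ∧ ∀ S ≤ K, IsPGroup p S → S ≤ T := by
  obtain ⟨P⟩ := (inferInstance : Nonempty (Sylow p K))
  refine ⟨(P : Subgroup K).map K.subtype, P.2.map _, fun S hSK hS => ?_⟩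
  obtain ⟨Q, hQ⟩ := (hS.comap_subtype (K := K)).exists_le_sylow
  have := Sylow.unique_of_normal P (h P)
  rw [Subsingleton.elim Q P] at hQ
  intro x hx
  exact ⟨⟨x, hSK hx⟩, hQ (Subgroup.mem_subgroupOf.2 hx), rfl⟩

theorem HasPermutablePrimaryElements.exists_normal_pgroup {G : Type*} [Group G] [Finite G]
    (hG : HasPermutablePrimaryElements G) {p : ℕ} (hp : p.Prime)
    (hmax : ∀ q : ℕ, q.Prime → q ∣ Nat.card G → q ≤ p) (hdvd : p ∣ Nat.card G)
    (hsub : ∀ K : Subgroup G, K ≠ ⊤ → ∃ T : Subgroup G, IsPGroup p T ∧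
      ∀ S ≤ K, IsPGroup p S → S ≤ T) :
    ∃ T : Subgroup G, T.Normal ∧ IsPGroup p T ∧ T ≠ ⊥ := by
  by_contra! hno
  have := Fact.mk hp
  obtain ⟨a, ha⟩ := exists_prime_orderOf_dvd_card' p hdvd
  have ha1 : a ≠ 1 := fun h => by rw [h, orderOf_one] at ha; exact hp.one_lt.ne ha
  have hzp : ∀ b : G, orderOf b = p → IsPGroup p (Subgroup.zpowers b) := fun b hb =>
    IsPGroup.of_card (n := 1) (by rw [Nat.card_zpowers, hb, pow_one])
  obtain ⟨P, hP⟩ := (hzp a ha).exists_le_sylow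
  have haP : a ∈ (P : Subgroup G) := hP (Subgroup.mem_zpowers a)
  have hPn : (P : Subgroup G).Normal := by
    rw [← Subgroup.normalizer_eq_top_iff, eq_top_iff]
    refine (hG a p 1 hp (by rw [ha, pow_one]) ⊤ trivial).trans ?_
    rw [Subgroup.closure_le]
    rintro y ⟨-, hy⟩
    by_cases hK : Subgroup.zpowers y ⊔ Subgroup.zpowers a = ⊤
    · obtain ⟨T, hT, hTp, hT1⟩ := exists_normal_pgroup_of_factorization hp hmax ha
        (fun g => Subgroup.mem_mul_of_mem_sup hy (hK ▸ Subgroup.mem_top g))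
      exact absurd (hno T hT hTp) hT1
    · obtain ⟨T, hTp, hT⟩ := hsub _ hK
      obtain ⟨Q, hQ⟩ := hTp.exists_le_sylow
      have hyK : y ∈ Subgroup.zpowers y ⊔ Subgroup.zpowers a :=
        Subgroup.mem_sup_left (Subgroup.mem_zpowers y)
      have haK : a ∈ Subgroup.zpowers y ⊔ Subgroup.zpowers a :=
        Subgroup.mem_sup_right (Subgroup.mem_zpowers a)
      have hmemQ : ∀ b ∈ Subgroup.zpowers y ⊔ Subgroup.zpowers a, orderOf b = p → b ∈ Q :=
        fun b hb hbp => hQ (hT _ (by simpa using hb) (hzp b hbp) (Subgroup.mem_zpowers b))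
      have hneb : ∀ (R S : Sylow p G) (b : G), orderOf b = p → b ∈ R → b ∈ S → R = S := by
        intro R S b hb hR hS
        refine Sylow.eq_of_inf_ne_bot hno hsub R S fun h => ?_
        have : b ∈ (R : Subgroup G) ⊓ S := ⟨hR, hS⟩
        rw [h, Subgroup.mem_bot] at this
        rw [this, orderOf_one] at hb
        exact hp.one_lt.ne hb
      have hPQ : P = Q := hneb P Q a ha haP (hmemQ a haK ha)
      -- Both a and its conjugate by y lie in the proper subgroup ⟨y⟩⟨a⟩, hence in the same Sylow
      -- subgroup P, so P and its conjugate by y meet nontrivially.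
      have hconj : orderOf (y * a * y⁻¹) = p := by
        rw [← ha]; exact orderOf_injective (MulAut.conj y).toMonoidHom (MulAut.conj y).injective a
      have h1 : y * a * y⁻¹ ∈ P := hPQ ▸ hmemQ _ (mul_mem (mul_mem hyK haK) (inv_mem hyK)) hconj
      have h2 : y * a * y⁻¹ ∈ y • P := by
        rw [← SetLike.mem_coe, Sylow.coe_smul]
        exact Set.smul_mem_smul_set (a := MulAut.conj y) haP
      exact Sylow.smul_eq_iff_mem_normalizer.1 (hneb _ _ _ hconj h2 h1)
  rw [hno _ hPn P.2, Subgroup.mem_bot] at haP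
  exact ha1 haP

/-- A Sylow subgroup for the largest prime is normal. -/
theorem HasPermutablePrimaryElements.sylow_normal {G : Type*} [Group G] [Finite G]
    (hG : HasPermutablePrimaryElements G) {p : ℕ} [hp : Fact p.Prime]
    (hmax : ∀ q : ℕ, q.Prime → q ∣ Nat.card G → q ≤ p) (P : Sylow p G) :
    (P : Subgroup G).Normal := by
  induction hn : Nat.card G using Nat.strong_induction_on generalizing G with
  | h n ih =>
    subst hn
    by_cases hdvd : p ∣ Nat.card G
    · have hsub : ∀ K : Subgroup G, K ≠ ⊤ → ∃ T : Subgroup G, IsPGroup p T ∧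
          ∀ S ≤ K, IsPGroup p S → S ≤ T := by
        intro K hK
        refine Subgroup.exists_largest_pgroup_of_sylow_normal fun Q => ?_
        have hlt : Nat.card K < Nat.card G := lt_of_le_of_ne (Subgroup.card_le_card_group K)
          fun h => hK (Subgroup.eq_top_of_card_eq K h)
        exact ih _ hlt (hG.subgroup K)
          (fun q hq hqK => hmax q hq (hqK.trans (Subgroup.card_subgroup_dvd_card K))) Q rfl
      obtain ⟨T, hT, hTp, hT1⟩ := hG.exists_normal_pgroup hp.1 hmax hdvd hsub
      have hsurj := QuotientGroup.mk'_surjective T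
      have hlt : Nat.card (G ⧸ T) < Nat.card G := by
        rw [Subgroup.card_eq_card_quotient_mul_card_subgroup T]
        exact lt_mul_of_one_lt_right Nat.card_pos
          ((Subgroup.one_lt_card_iff_ne_bot T).2 hT1)
      have h1 := ih _ hlt (hG.of_surjective hsurj)
        (fun q hq hqK => hmax q hq (hqK.trans (Subgroup.card_quotient_dvd_card T)))
        (P.mapSurjective hsurj) rfl
      rw [Sylow.coe_mapSurjective] at h1
      have h2 := h1.comap (QuotientGroup.mk' T)
      rwa [Subgroup.comap_map_eq_self] at h2
      rw [QuotientGroup.ker_mk']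
      exact hTp.le_sylow_of_normal P
    -- Subgroups and quotients in the induction may have order prime to p.
    · obtain ⟨k, hk⟩ := IsPGroup.iff_card.1 P.2
      have hbot : (P : Subgroup G) = ⊥ := by
        rw [← Subgroup.card_eq_one, hk]
        rcases Nat.eq_zero_or_pos k with rfl | hk0
        · exact pow_zero p
        · exact absurd ((dvd_pow_self p hk0.ne').trans
            (hk ▸ Subgroup.card_subgroup_dvd_card (P : Subgroup G))) hdvd
      rw [hbot]
      infer_instance

/-! ### Irreducible actions with quadratic primary elements -/

/-- The elements of `G` that stabilize the submodule `W` under the action `ρ`. -/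
def moduleStabilizer {F V G : Type*} [Field F] [AddCommGroup V] [Module F V] [Group G]
    (ρ : G →* Module.End F V) (W : Submodule F V) : Subgroup G where
  carrier := {g | ∀ v ∈ W, ρ g v ∈ W ∧ ρ g⁻¹ v ∈ W}
  one_mem' := fun v hv => by simpa using hv
  mul_mem' := fun {a b} ha hb v hv => by
    rw [mul_inv_rev, map_mul, map_mul]
    exact ⟨(ha _ (hb v hv).1).1, (hb _ (ha v hv).2).2⟩
  inv_mem' := fun {a} ha v hv => by
    rw [inv_inv]
    exact (ha v hv).symm

theorem Module.End.pow_apply_of_apply_eq_smul {F V : Type*} [Field F] [AddCommGroup V] [Module F V]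
    {f : Module.End F V} {c : F} {v : V} (h : f v = c • v) (n : ℕ) : (f ^ n) v = c ^ n • v := by
  induction n with
  | zero => simp
  | succ n ih => rw [pow_succ, Module.End.mul_apply, h, map_smul, ih, smul_smul, pow_succ']

theorem eq_one_or_eq_of_quadratic {F V : Type*} [Field F] [AddCommGroup V] [Module F V]
    {B : Module.End F V} {l z : F} (hB : ∀ v, B (B v) = (1 + l) • B v - l • v)
    {u : V} (hu : u ≠ 0) (hz : B u = z • u) : z = 1 ∨ z = l := by
  have h := hB u
  rw [hz, map_smul, hz] at h
  have h1 : ((z - 1) * (z - l)) • u = 0 := by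
    rw [show ((z - 1) * (z - l)) • u = z • z • u - ((1 + l) • z • u - l • u) by module, h, sub_self]
  rcases smul_eq_zero.1 h1 with h2 | h2
  · exact (mul_eq_zero.1 h2).imp sub_eq_zero.1 sub_eq_zero.1
  · exact absurd h2 hu

/-- Let `G` act irreducibly so that every element acting with prime power order satisfies
`(g - 1) (g - l) = 0` for a scalar `l`. Then an element `b` acting with prime power order
and generating a normal subgroup modulo the scalars acts as a scalar. -/
theorem exists_scalar_of_quadratic {F V G : Type*} [Field F] [AddCommGroup V] [Module F V]
    [Group G] [Finite G] (ρ : G →* Module.End F V)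
    (hirr : ∀ W : Submodule F V, (∀ g, ∀ w ∈ W, ρ g w ∈ W) → W = ⊥ ∨ W = ⊤)
    (hquad : ∀ (g : G) (q k : ℕ), q.Prime → ρ g ^ q ^ k = 1 →
      ∃ l : F, ∀ v, ρ g (ρ g v) = (1 + l) • ρ g v - l • v)
    (b : G) {q k : ℕ} (hq : q.Prime) (hbq : ρ b ^ q ^ k = 1)
    (hconj : ∀ r : G, ∃ (i : ℕ) (z : F), ∀ v, ρ (r⁻¹ * b * r) v = z • (ρ b ^ i) v) :
    ∃ c : F, ∀ v, ρ b v = c • v := by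
  by_contra! hb
  obtain ⟨l, hl⟩ := hquad b q k hq hbq
  have hinv : ∀ (g : G) (v : V), ρ g⁻¹ (ρ g v) = v := fun g v => by
    rw [← Module.End.mul_apply, ← map_mul, inv_mul_cancel, map_one, Module.End.one_apply]
  have hinv' : ∀ (g : G) (v : V), ρ g (ρ g⁻¹ v) = v := fun g v => by
    rw [← Module.End.mul_apply, ← map_mul, mul_inv_cancel, map_one, Module.End.one_apply]
  have hinj : ∀ (g : G) (v : V), v ≠ 0 → ρ g v ≠ 0 := fun g v hv h => hv (by
    rw [← hinv g v, h, map_zero])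
  let K := Module.End.eigenspace (ρ b) 1
  let K' := Module.End.eigenspace (ρ b) l
  have hK : ∀ v, v ∈ K ↔ ρ b v = v := fun v => by
    rw [Module.End.mem_eigenspace_iff, one_smul]
  have hK' : ∀ v, v ∈ K' ↔ ρ b v = l • v := fun v => Module.End.mem_eigenspace_iff
  have hmemK : ∀ v, ρ b v - l • v ∈ K := fun v => by
    rw [hK, map_sub, hl, map_smul]; module
  have hmemK' : ∀ v, ρ b v - v ∈ K' := fun v => by
    rw [hK', map_sub, hl]; module
  obtain ⟨v₁, hv₁K, hv₁⟩ : ∃ v ∈ K, v ≠ 0 := by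
    obtain ⟨v, hv⟩ := hb l
    exact ⟨_, hmemK v, sub_ne_zero.2 hv⟩
  obtain ⟨v₂, hv₂K, hv₂⟩ : ∃ v ∈ K', v ≠ 0 := by
    obtain ⟨v, hv⟩ := hb 1
    exact ⟨_, hmemK' v, sub_ne_zero.2 (by rwa [one_smul] at hv)⟩
  -- Since b r = r (z b^i) on V, r carries each eigenspace of b into an eigenspace of b.
  have htr : ∀ r : G, ∃ z : F, ∃ w : F, (∀ v ∈ K, ρ b (ρ r v) = z • ρ r v) ∧
      ∀ v ∈ K', ρ b (ρ r v) = w • ρ r v := by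
    intro r
    obtain ⟨i, z, hz⟩ := hconj r
    have h0 : ∀ v, ρ b (ρ r v) = ρ r (z • (ρ b ^ i) v) := fun v => by
      rw [← hz, ← Module.End.mul_apply, ← Module.End.mul_apply, ← map_mul, ← map_mul]
      congr 2; group
    refine ⟨z, z * l ^ i, fun v hv => ?_, fun v hv => ?_⟩
    · have : (ρ b ^ i) v = v := by
        rw [Module.End.pow_apply_of_apply_eq_smul (c := 1) (by rw [(hK v).1 hv, one_smul]), one_pow,
          one_smul]
      rw [h0, this, map_smul]
    · have : (ρ b ^ i) v = l ^ i • v :=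
        Module.End.pow_apply_of_apply_eq_smul ((hK' v).1 hv) i
      rw [h0, this, map_smul, map_smul, smul_smul]
  have htrK : ∀ r : G, (∀ v ∈ K, ρ r v ∈ K) ∨ ∀ v ∈ K, ρ r v ∈ K' := by
    intro r
    obtain ⟨z, -, hz, -⟩ := htr r
    rcases eq_one_or_eq_of_quadratic hl (hinj r v₁ hv₁) (hz v₁ hv₁K) with rfl | rfl
    · exact Or.inl fun v hv => (hK _).2 (by rw [hz v hv, one_smul])
    · exact Or.inr fun v hv => (hK' _).2 (hz v hv)
  have htrK' : ∀ r : G, (∀ v ∈ K', ρ r v ∈ K) ∨ ∀ v ∈ K', ρ r v ∈ K' := by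
    intro r
    obtain ⟨-, z, -, hz⟩ := htr r
    rcases eq_one_or_eq_of_quadratic hl (hinj r v₂ hv₂) (hz v₂ hv₂K) with rfl | rfl
    · exact Or.inl fun v hv => (hK _).2 (by rw [hz v hv, one_smul])
    · exact Or.inr fun v hv => (hK' _).2 (hz v hv)
  -- If all elements of prime power order preserved K, all of G would, against irreducibility.
  obtain ⟨r, p, n, hp, hrp, hr⟩ : ∃ (r : G) (p n : ℕ), p.Prime ∧ ρ r ^ p ^ n = 1 ∧
      ¬ ∀ v ∈ K, ρ r v ∈ K := by
    by_contra! hall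
    have hstab : ∀ g, g ∈ moduleStabilizer ρ K := fun g =>
      Subgroup.mem_of_primary_powers_mem _ g fun m p n hp hm v hv => by
        have h1 : (g ^ m) ^ p ^ n = 1 := hm ▸ pow_orderOf_eq_one _
        exact ⟨hall _ p n hp (by rw [← map_pow, h1, map_one]) v hv,
          hall _ p n hp (by rw [← map_pow, inv_pow, h1, inv_one, map_one]) v hv⟩
    rcases hirr K fun g w hw => (hstab g w hw).1 with h | h
    · rw [h, Submodule.mem_bot] at hv₁K
      exact hv₁ hv₁K
    · obtain ⟨v, hv⟩ := hb 1
      exact hv (by rw [one_smul, (hK v).1 (h ▸ Submodule.mem_top)])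
  have hl1 : l ≠ 1 := by
    rintro rfl
    exact hr ((htrK r).elim id id)
  have hdisj : ∀ v ∈ K, v ∈ K' → v = 0 := fun v h h' => by
    have h1 : (1 - l) • v = 0 := by
      rw [sub_smul, one_smul, ← (hK' v).1 h', (hK v).1 h, sub_self]
    exact (smul_eq_zero.1 h1).resolve_left (sub_ne_zero.2 hl1.symm)
  have hdec : ∀ v, v = (1 - l)⁻¹ • (ρ b v - l • v) - (1 - l)⁻¹ • (ρ b v - v) := fun v => by
    rw [← smul_sub, show ρ b v - l • v - (ρ b v - v) = (1 - l) • v by module, smul_smul,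
      inv_mul_cancel₀ (sub_ne_zero.2 hl1.symm), one_smul]
  have hext : ∀ f g : Module.End F V, (∀ v ∈ K, f v = g v) → (∀ v ∈ K', f v = g v) → f = g := by
    intro f g h h'
    ext v
    rw [hdec v, map_sub, map_smul, map_smul, h _ (hmemK v), h' _ (hmemK' v), ← map_smul, ← map_smul,
      ← map_sub]
  have hrK : ∀ v ∈ K, ρ r v ∈ K' := (htrK r).resolve_left hr
  have hrK' : ∀ v ∈ K', ρ r v ∈ K := by
    refine (htrK' r).resolve_right fun h => ?_
    obtain ⟨v, hv⟩ := hb l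
    refine hv ((hK' v).1 ?_)
    have h1 : ∀ u, ρ r u ∈ K' := fun u => by
      rw [hdec u, map_sub, map_smul, map_smul]
      exact sub_mem (K'.smul_mem _ (hrK _ (hmemK u))) (K'.smul_mem _ (h _ (hmemK' u)))
    rw [← hinv' r v]
    exact h1 _
  have hswap : ∀ (g : G) (p n : ℕ), p.Prime → ρ g ^ p ^ n = 1 → (∀ v ∈ K, ρ g v ∈ K') →
      (∀ v ∈ K', ρ g v ∈ K) → ∀ v, ρ g (ρ g v) = v := by
    intro g p n hp hg h h'
    obtain ⟨m, hm⟩ := hquad g p n hp hg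
    -- The vector g² v₁ + m v₁ lies in K and equals (1 + m) g v₁, which lies in K'.
    have h1 : (1 + m) • ρ g v₁ = 0 := by
      refine hdisj _ ?_ (K'.smul_mem _ (h _ hv₁K))
      rw [show (1 + m) • ρ g v₁ = ρ g (ρ g v₁) + m • v₁ by rw [hm]; module]
      exact add_mem (h' _ (h _ hv₁K)) (K.smul_mem _ hv₁K)
    have h2 : m = -1 := by
      rw [eq_neg_iff_add_eq_zero, add_comm]
      exact (smul_eq_zero.1 h1).resolve_right (hinj g v₁ hv₁)
    intro v
    rw [hm, h2]
    module
  have hrr := hswap r p n hp hrp hrK hrK'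
  have hlq : l ^ q ^ k = 1 := by
    have h1 : (ρ b ^ q ^ k) v₂ = l ^ q ^ k • v₂ :=
      Module.End.pow_apply_of_apply_eq_smul ((hK' v₂).1 hv₂K) _
    rw [hbq, Module.End.one_apply] at h1
    have h2 : (1 - l ^ q ^ k) • v₂ = 0 := by rw [sub_smul, ← h1, one_smul, sub_self]
    exact (sub_eq_zero.1 ((smul_eq_zero.1 h2).resolve_right hv₂)).symm
  have hl0 : l ≠ 0 := by
    rintro rfl
    rw [zero_pow (pow_ne_zero _ hq.ne_zero)] at hlq
    exact zero_ne_one hlq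
  have hlneg : l = -1 := by
    -- The commutator acts as l on K and as l⁻¹ on K'. One of its two admissible eigenvalues is 1,
    -- so l ≠ 1 forces l = l⁻¹.
    have hc : ∀ v ∈ K, ρ (b⁻¹ * (r⁻¹ * b * r)) v = l • v := fun v hv => by
      simp only [map_mul, Module.End.mul_apply]
      rw [(hK' _).1 (hrK v hv), map_smul, hinv, map_smul]
      congr 1
      conv_lhs => rw [← (hK v).1 hv]
      exact hinv b v
    have hc' : ∀ v ∈ K', ρ (b⁻¹ * (r⁻¹ * b * r)) v = l⁻¹ • v := fun v hv => by
      simp only [map_mul, Module.End.mul_apply]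
      rw [(hK _).1 (hrK' v hv), hinv]
      have := hinv b v
      rw [(hK' v).1 hv, map_smul] at this
      rw [eq_inv_smul_iff₀ hl0, this]
    obtain ⟨m, hm⟩ := hquad (b⁻¹ * (r⁻¹ * b * r)) q k hq 
      (hext _ _
        (fun v hv => by
          rw [Module.End.pow_apply_of_apply_eq_smul (hc v hv), hlq, one_smul, Module.End.one_apply])
        fun v hv => by
          rw [Module.End.pow_apply_of_apply_eq_smul (hc' v hv), inv_pow, hlq, inv_one, one_smul,
            Module.End.one_apply])
    have hml := (eq_one_or_eq_of_quadratic hm hv₁ (hc v₁ hv₁K)).resolve_left hl1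
    rcases eq_one_or_eq_of_quadratic hm hv₂ (hc' v₂ hv₂K) with h | h
    · exact absurd (inv_eq_one.1 h) hl1
    · have hll : l * l = 1 := by
        calc l * l = l⁻¹ * l := by rw [h, ← hml]
          _ = 1 := inv_mul_cancel₀ hl0
      rcases mul_self_eq_one_iff.1 hll with h' | h'
      · exact absurd h' hl1
      · exact h'
  have hg : ∀ v ∈ K, ρ (r * b) v = ρ r v := fun v hv => by
    rw [map_mul, Module.End.mul_apply, (hK v).1 hv]
  have hg' : ∀ v ∈ K', ρ (r * b) v = - ρ r v := fun v hv => by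
    rw [map_mul, Module.End.mul_apply, (hK' v).1 hv, hlneg, neg_one_smul, map_neg]
  -- The element r b also swaps K and K' but squares to -1. Its order divides 4, so `hswap` makes
  -- its square 1, whence -1 = 1 and l = 1.
  have hsq : ρ (r * b) ^ 2 = -1 := by
    refine hext _ _ (fun v hv => ?_) fun v hv => ?_
    · rw [pow_two, Module.End.mul_apply, hg v hv, hg' _ (hrK v hv), hrr]
      rfl
    · rw [pow_two, Module.End.mul_apply, hg' v hv, map_neg, hg _ (hrK' v hv), hrr]
      rfl
  have h4 : ρ (r * b) ^ 2 ^ 2 = 1 := by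
    rw [pow_two 2, pow_mul, hsq, neg_one_sq]
  have h5 := hswap (r * b) 2 2 Nat.prime_two h4 (fun v hv => hg v hv ▸ hrK v hv)
    (fun v hv => hg' v hv ▸ neg_mem (hrK' v hv)) v₁
  rw [← Module.End.mul_apply, ← pow_two, hsq, LinearMap.neg_apply, Module.End.one_apply] at h5
  have h6 : (l - 1) • v₁ = 0 := by
    rw [sub_smul, hlneg, neg_one_smul, one_smul, h5, sub_self]
  exact hl1 (sub_eq_zero.1 ((smul_eq_zero.1 h6).resolve_right hv₁))

/-! ### The normal subgroup as a module -/

/-- A linear model of the conjugation action of `G` on a normal elementary abelian `p`-subgroup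
`N`. -/
structure ConjugationModule {G : Type u} [Group G] (p : ℕ) (N : Subgroup G) (V : Type u)
    [AddCommGroup V] [Module (ZMod p) V] where
  /-- the identification of `V` with `N` -/
  toGroup : V → G
  /-- the conjugation action -/
  action : G →* Module.End (ZMod p) V
  injective : Function.Injective toGroup
  map_add : ∀ v w, toGroup (v + w) = toGroup v * toGroup w
  mem_iff : ∀ g, g ∈ N ↔ ∃ v, toGroup v = g
  map_action : ∀ g v, toGroup (action g v) = g * toGroup v * g⁻¹

/-- An action by additive maps on a `ZMod p`-module is linear. -/
def zmodActionOfAdditive {G A : Type*} [Group G] [AddCommGroup A] (p : ℕ) [Module (ZMod p) A]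
    (c : G → A →+ A) (h1 : ∀ v, c 1 v = v) (hmul : ∀ g h v, c (g * h) v = c g (c h v)) :
    G →* Module.End (ZMod p) A where
  toFun g := (c g).toZModLinearMap p
  map_one' := LinearMap.ext fun v => h1 v
  map_mul' g h := LinearMap.ext fun v => hmul g h v

theorem ConjugationModule.exists_of_addCommGroup {G : Type u} [Group G] {p : ℕ} {N : Subgroup G}
    {A : Type u} [AddCommGroup A] (hp : ∀ a : A, p • a = 0) (f : A → G)
    (hf : Function.Injective f) (hadd : ∀ a b, f (a + b) = f a * f b)
    (hN : ∀ g, g ∈ N ↔ ∃ a, f a = g) (c : G → A →+ A)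
    (hc : ∀ g a, f (c g a) = g * f a * g⁻¹) :
    ∃ (V : Type u) (_ : AddCommGroup V) (_ : Module (ZMod p) V),
      Nonempty (ConjugationModule p N V) := by
  let _ : Module (ZMod p) A := AddCommGroup.zmodModule hp
  exact ⟨A, inferInstance, inferInstance, ⟨
    { toGroup := f
      action := zmodActionOfAdditive p c (fun v => hf (by rw [hc]; group))
        (fun g h v => hf (by rw [hc, hc, hc]; group))
      injective := hf
      map_add := hadd
      mem_iff := hN
      map_action := hc }⟩⟩

theorem ConjugationModule.exists_of_elementary {G : Type u} [Group G] {p : ℕ} (N : Subgroup G)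
    [N.Normal] (hc : ∀ x ∈ N, ∀ y ∈ N, x * y = y * x) (hp : ∀ x ∈ N, x ^ p = 1) :
    ∃ (V : Type u) (_ : AddCommGroup V) (_ : Module (ZMod p) V),
      Nonempty (ConjugationModule p N V) := by
  let _ : CommGroup N := { N.toGroup with mul_comm := fun x y => Subtype.ext (hc x x.2 y y.2) }
  exact exists_of_addCommGroup (A := Additive N) (fun x => Subtype.ext (hp x.toMul x.toMul.2))
    (fun v => (v.toMul : G)) N.subtype_injective (fun _ _ => rfl)
    (fun g => ⟨fun h => ⟨Additive.ofMul ⟨g, h⟩, rfl⟩, fun ⟨a, ha⟩ => ha ▸ a.toMul.2⟩)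
    (fun g =>
      { toFun := fun v => Additive.ofMul (MulAut.conjNormal (H := N) g v.toMul)
        map_zero' := congrArg Additive.ofMul (map_one (MulAut.conjNormal (H := N) g))
        map_add' := fun v w =>
          congrArg Additive.ofMul (map_mul (MulAut.conjNormal (H := N) g) v.toMul w.toMul) })
    (fun g v => MulAut.conjNormal_apply g v.toMul)

namespace ConjugationModule

variable {G : Type u} [Group G] {p : ℕ} {N : Subgroup G} {V : Type u}
  [AddCommGroup V] [Module (ZMod p) V] (M : ConjugationModule p N V)

theorem toGroup_mem (v : V) : M.toGroup v ∈ N := (M.mem_iff _).2 ⟨v, rfl⟩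

theorem toGroup_zero : M.toGroup 0 = 1 := by
  have h := M.map_add 0 0
  rwa [add_zero, left_eq_mul] at h

/-- `ConjugationModule.toGroup` as a homomorphism. -/
def hom : Multiplicative V →* G where
  toFun v := M.toGroup v.toAdd
  map_one' := M.toGroup_zero
  map_mul' _ _ := M.map_add _ _

theorem toGroup_zsmul (n : ℤ) (v : V) : M.toGroup (n • v) = M.toGroup v ^ n :=
  map_zpow M.hom (Multiplicative.ofAdd v) n

theorem toGroup_neg (v : V) : M.toGroup (-v) = (M.toGroup v)⁻¹ :=
  map_inv M.hom (Multiplicative.ofAdd v)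

theorem exists_smul_eq_zsmul (c : ZMod p) : ∃ n : ℤ, ∀ v : V, c • v = n • v := by
  obtain ⟨n, rfl⟩ := ZMod.intCast_surjective c
  exact ⟨n, fun v => Int.cast_smul_eq_zsmul _ n v⟩

/-- Writing a for the group element of v, x a = a^s x^t gives a^(-s) (x a x⁻¹) = x^(t-1). This
element of N commutes with x, so it is a fixed vector w. -/
theorem action_of_permutes {x : G} {v : V}
    (h : (Subgroup.zpowers x : Set G) * (Subgroup.zpowers (M.toGroup v) : Set G) =
      (Subgroup.zpowers (M.toGroup v) : Set G) * (Subgroup.zpowers x : Set G)) :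
    ∃ (s : ZMod p) (w : V), M.action x v = s • v + w ∧ M.action x w = w := by
  have h1 : x * M.toGroup v ∈
      (Subgroup.zpowers (M.toGroup v) : Set G) * (Subgroup.zpowers x : Set G) :=
    h ▸ Set.mul_mem_mul (Subgroup.mem_zpowers x) (Subgroup.mem_zpowers _)
  obtain ⟨_, ⟨s, rfl⟩, _, ⟨t, rfl⟩, hst⟩ := Set.mem_mul.1 h1
  have hw : M.toGroup (M.action x v - s • v) = x ^ (t - 1) := by
    rw [sub_eq_neg_add, M.map_add, M.map_action, M.toGroup_neg, M.toGroup_zsmul, ← hst]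
    group
  refine ⟨s, M.action x v - s • v, ?_, M.injective ?_⟩
  · rw [Int.cast_smul_eq_zsmul]; abel
  · rw [M.map_action, hw]
    group

theorem action_sq_of_permutes {x g : G} {n : ℕ} (hxg : M.action g = M.action x ^ n) {v : V}
    (h : (Subgroup.zpowers x : Set G) * (Subgroup.zpowers (M.toGroup v) : Set G) =
      (Subgroup.zpowers (M.toGroup v) : Set G) * (Subgroup.zpowers x : Set G)) :
    ∃ l : ZMod p, M.action g (M.action g v) = (1 + l) • M.action g v - l • v := by
  obtain ⟨s, w, hv, hw⟩ := M.action_of_permutes h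
  have key : ∀ n : ℕ, (∃ c : ZMod p, (M.action x ^ n) v = s ^ n • v + c • w) ∧
      (M.action x ^ n) w = w := by
    intro n
    induction n with
    | zero => exact ⟨⟨0, by simp⟩, rfl⟩
    | succ n ih =>
      obtain ⟨⟨c, hc⟩, hn⟩ := ih
      refine ⟨⟨s ^ n + c, ?_⟩, ?_⟩
      · rw [pow_succ', Module.End.mul_apply, hc, _root_.map_add, map_smul, map_smul, hv, hw]
        module
      · rw [pow_succ', Module.End.mul_apply, hn, hw]
  obtain ⟨⟨c, hc⟩, hn⟩ := key n
  refine ⟨s ^ n, ?_⟩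
  rw [hxg, hc, _root_.map_add, map_smul, map_smul, hc, hn]
  module

/-- Apply the hypothesis in the preimage U of ⟨φ g⟩. Elements permuting with ⟨v⟩ generate U, so one
of them avoids the preimage of the proper subgroup ⟨(φ g)^q⟩; its image then generates the cyclic
q-group ⟨φ g⟩, and g acts as a power of it. -/
theorem exists_action_sq_apply [Finite G] (hG : HasPermutablePrimaryElements G)
    (hp : p.Prime) {g : G} {q k : ℕ} (hq : q.Prime) (hg : M.action g ^ q ^ k = 1) (v : V) :
    ∃ l : ZMod p, M.action g (M.action g v) = (1 + l) • M.action g v - l • v := by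
  by_cases hv : v = 0
  · exact ⟨0, by simp [hv]⟩
  by_cases hg1 : M.action g = 1
  · exact ⟨0, by simp [hg1]⟩
  set φ := M.action.toHomUnits with hφ
  have hφv : ∀ x, (φ x : Module.End (ZMod p) V) = M.action x := fun x => rfl
  have hgq : φ g ^ q ^ k = 1 := Units.ext (by rw [Units.val_pow_eq_pow_val, hφv, hg, Units.val_one])
  have hfin : IsOfFinOrder (φ g) := isOfFinOrder_iff_pow_eq_one.2
    ⟨_, pow_pos hq.pos k, hgq⟩
  obtain ⟨j, -, hj⟩ := (Nat.dvd_prime_pow hq).1 (orderOf_dvd_of_pow_eq_one hgq)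
  have hgU : g ∉ (Subgroup.zpowers (φ g ^ q)).comap φ := by
    intro h
    rw [Subgroup.mem_comap] at h
    have h1 := orderOf_dvd_of_mem_zpowers h
    cases j with
    | zero =>
      rw [pow_zero, orderOf_eq_one_iff] at hj
      exact hg1 (by rw [← hφv, hj, Units.val_one])
    | succ j =>
      have h2 : orderOf (φ g ^ q) ∣ q ^ j := orderOf_dvd_of_pow_eq_one (by
        rw [← pow_mul, ← pow_succ', ← hj, pow_orderOf_eq_one])
      have h3 := (hj ▸ h1).trans h2
      exact absurd (Nat.pow_dvd_pow_iff_le_right hq.one_lt |>.1 h3) (by omega)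
  have hav : orderOf (M.toGroup v) = p ^ 1 := by
    rw [pow_one]
    have := Fact.mk hp
    refine orderOf_eq_prime ?_ fun h => hv (M.injective (h.trans M.toGroup_zero.symm))
    rw [← zpow_natCast, ← M.toGroup_zsmul, ← Int.cast_smul_eq_zsmul (ZMod p)]
    simp [M.toGroup_zero]
  have hact1 : ∀ w : V, M.action (M.toGroup v) w = w := fun w => M.injective (by
    rw [M.map_action, ← M.map_add, add_comm, M.map_add, mul_inv_cancel_right])
  have haU : M.toGroup v ∈ (Subgroup.zpowers (φ g)).comap φ := by
    rw [Subgroup.mem_comap]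
    have : φ (M.toGroup v) = 1 := Units.ext (LinearMap.ext hact1)
    rw [this]
    exact one_mem _
  have h1 := hG _ p 1 hp hav _ haU
  obtain ⟨x, hx, hxU, hxa⟩ : ∃ x, x ∈ (Subgroup.zpowers (φ g)).comap φ ∧
      x ∉ (Subgroup.zpowers (φ g ^ q)).comap φ ∧
      (Subgroup.zpowers x : Set G) * (Subgroup.zpowers (M.toGroup v) : Set G) =
        (Subgroup.zpowers (M.toGroup v) : Set G) * (Subgroup.zpowers x : Set G) := by
    by_contra! hall
    refine hgU ((Subgroup.closure_le _).2 ?_ (h1 (Subgroup.mem_zpowers (φ g))))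
    rintro x ⟨hx, hxa⟩
    by_contra hxU
    exact hall x hx hxU hxa
  rw [Subgroup.mem_comap, ← hfin.mem_powers_iff_mem_zpowers] at hx
  obtain ⟨i, hi⟩ := hx
  have hco : i.Coprime (orderOf (φ g)) := by
    rw [hj]
    refine Nat.Coprime.pow_right _ (Nat.Coprime.symm ((Nat.Prime.coprime_iff_not_dvd hq).2 ?_))
    rintro ⟨t, rfl⟩
    refine hxU (Subgroup.mem_comap.2 ⟨t, ?_⟩)
    simp only [zpow_natCast, ← pow_mul]
    exact hi
  obtain ⟨n, hn⟩ := exists_pow_eq_self_of_coprime hco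
  have hi' : φ g ^ i = φ x := hi
  refine M.action_sq_of_permutes (x := x) (n := n) ?_ hxa
  rw [← hφv, ← hφv, ← Units.val_pow_eq_pow_val, ← hi', hn]

end ConjugationModule

/-- The relation says that f v - v is zero or an eigenvector for l; a linear map for which every
vector of the image of f - 1 is an eigenvector is scalar on that image. -/
theorem Module.End.exists_quadratic_of_forall {F V : Type*} [Field F] [AddCommGroup V]
    [Module F V] (f : Module.End F V)
    (h : ∀ v, ∃ l : F, f (f v) = (1 + l) • f v - l • v) :
    ∃ l : F, ∀ v, f (f v) = (1 + l) • f v - l • v := by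
  have key : ∀ (v : V) (l : F), f (f v) = (1 + l) • f v - l • v ↔ f (f v - v) = l • (f v - v) := by
    intro v l
    rw [map_sub, sub_eq_iff_eq_add, show l • (f v - v) + f v = (1 + l) • f v - l • v by module]
  simp only [key] at h ⊢
  by_cases h0 : ∃ v, f v - v ≠ 0
  · obtain ⟨v, hv⟩ := h0
    obtain ⟨l, hl⟩ := h v
    refine ⟨l, fun w => ?_⟩
    obtain ⟨m, hm⟩ := h w
    obtain ⟨c, hc⟩ := h (v + w)
    have e : f (v + w) - (v + w) = (f v - v) + (f w - w) := by rw [map_add]; abel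
    rw [e, map_add, hl, hm] at hc
    have h1 : (l - c) • (f v - v) = (c - m) • (f w - w) := by
      rw [sub_smul, sub_smul, sub_eq_sub_iff_add_eq_add, hc]; module
    by_cases hcm : c - m = 0
    · rw [hcm, zero_smul, smul_eq_zero] at h1
      rw [hm, sub_eq_zero.1 (h1.resolve_right hv), sub_eq_zero.1 hcm]
    · have h2 : f w - w = ((c - m)⁻¹ * (l - c)) • (f v - v) := by
        rw [mul_smul, h1, smul_smul, inv_mul_cancel₀ hcm, one_smul]
      rw [h2, map_smul, hl, smul_comm]
  · push Not at h0
    exact ⟨0, fun v => by rw [h0 v]; simp⟩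

namespace ConjugationModule

variable {G : Type u} [Group G] {p : ℕ} {N : Subgroup G} {V : Type u}
  [AddCommGroup V] [Module (ZMod p) V] (M : ConjugationModule p N V)

/-- The subgroup of `N` corresponding to a submodule. -/
def ofSubmodule (W : Submodule (ZMod p) V) : Subgroup G :=
  W.toAddSubgroup.toSubgroup.map M.hom

theorem mem_ofSubmodule {W : Submodule (ZMod p) V} {g : G} :
    g ∈ M.ofSubmodule W ↔ ∃ w ∈ W, M.toGroup w = g := Iff.rfl

theorem eq_bot_or_eq_top
    (hmin : ∀ L : Subgroup G, L.Normal → L ≤ N → L = ⊥ ∨ L = N) (W : Submodule (ZMod p) V)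
    (hW : ∀ g, ∀ w ∈ W, M.action g w ∈ W) : W = ⊥ ∨ W = ⊤ := by
  have hn : (M.ofSubmodule W).Normal := by
    refine ⟨fun x hx g => ?_⟩
    obtain ⟨w, hw, rfl⟩ := M.mem_ofSubmodule.1 hx
    exact M.mem_ofSubmodule.2 ⟨_, hW g w hw, M.map_action g w⟩
  have hle : M.ofSubmodule W ≤ N := fun x hx => by
    obtain ⟨w, -, rfl⟩ := M.mem_ofSubmodule.1 hx
    exact M.toGroup_mem w
  refine (hmin _ hn hle).imp (fun h => (Submodule.eq_bot_iff _).2 fun w hw => ?_) fun h => ?_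
  · have h1 : M.toGroup w ∈ M.ofSubmodule W := ⟨w, hw, rfl⟩
    rw [h, Subgroup.mem_bot, ← M.toGroup_zero] at h1
    exact M.injective h1
  · refine Submodule.eq_top_iff'.2 fun v => ?_
    have h1 : M.toGroup v ∈ M.ofSubmodule W := by rw [h]; exact M.toGroup_mem v
    obtain ⟨w, hw, hwv⟩ := M.mem_ofSubmodule.1 h1
    rwa [← M.injective hwv]

variable [Fact p.Prime]

/-- The elements of `G` acting on `V` as scalars. -/
def scalars : Subgroup G where
  carrier := {g | ∃ c : ZMod p, ∀ v, M.action g v = c • v}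
  one_mem' := ⟨1, fun v => by simp⟩
  mul_mem' := by
    rintro g h ⟨c, hc⟩ ⟨d, hd⟩
    exact ⟨c * d, fun v => by
      rw [map_mul, Module.End.mul_apply, hd, map_smul, hc, smul_smul, mul_comm]⟩
  inv_mem' := by
    rintro g ⟨c, hc⟩
    have h : ∀ v, M.action g (M.action g⁻¹ v) = v := fun v => by
      rw [← Module.End.mul_apply, ← map_mul, mul_inv_cancel, map_one, Module.End.one_apply]
    refine ⟨c⁻¹, fun v => ?_⟩
    by_cases hc0 : c = 0
    · have h0 : ∀ w : V, w = 0 := fun w => by rw [← h w, hc, hc0, zero_smul]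
      rw [h0 (M.action g⁻¹ v), h0 (c⁻¹ • v)]
    · rw [eq_inv_smul_iff₀ hc0, ← hc, h]

theorem le_scalars (hc : ∀ x ∈ N, ∀ y ∈ N, x * y = y * x) : N ≤ M.scalars := by
  refine fun g hg => ⟨1, fun v => M.injective ?_⟩
  rw [M.map_action, hc g hg _ (M.toGroup_mem v), one_smul, mul_inv_cancel_right]

theorem isCyclic_of_scalars_eq_top
    (hmin : ∀ L : Subgroup G, L.Normal → L ≤ N → L = ⊥ ∨ L = N) (h : M.scalars = ⊤) :
    ∃ a ∈ N, ∀ x ∈ N, x ∈ Subgroup.zpowers a := by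
  by_cases h0 : ∃ v : V, v ≠ 0
  · obtain ⟨v, hv⟩ := h0
    refine ⟨M.toGroup v, M.toGroup_mem v, fun x hx => ?_⟩
    have h1 : Submodule.span (ZMod p) {v} = ⊤ := by
      refine (M.eq_bot_or_eq_top hmin _ fun g w hw => ?_).resolve_left fun hbot => hv ?_
      · obtain ⟨c, hc⟩ : g ∈ M.scalars := h ▸ Subgroup.mem_top g
        rw [hc]
        exact Submodule.smul_mem _ _ hw
      · rwa [Submodule.span_singleton_eq_bot] at hbot
    obtain ⟨w, rfl⟩ := (M.mem_iff x).1 hx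
    obtain ⟨c, rfl⟩ := Submodule.mem_span_singleton.1 (h1 ▸ Submodule.mem_top : w ∈ _)
    obtain ⟨n, hn⟩ := exists_smul_eq_zsmul (V := V) c
    exact ⟨n, by rw [hn, M.toGroup_zsmul]⟩
  · push Not at h0
    refine ⟨1, N.one_mem, fun x hx => ?_⟩
    obtain ⟨w, rfl⟩ := (M.mem_iff x).1 hx
    rw [h0 w, M.toGroup_zero]
    exact one_mem _

theorem scalars_eq_top [Finite G] (hG : HasPermutablePrimaryElements G)
    (hc : ∀ x ∈ N, ∀ y ∈ N, x * y = y * x)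
    (hmin : ∀ L : Subgroup G, L.Normal → L ≤ N → L = ⊥ ∨ L = N)
    (hβ : ∀ Z : Subgroup G, N ≤ Z → Z ≠ ⊤ →
      ∃ β ∉ Z, ∀ r : G, ∃ i : ℕ, ∃ z ∈ Z, r⁻¹ * β * r = β ^ i * z) :
    M.scalars = ⊤ := by
  by_contra htop
  obtain ⟨β, hβZ, hβr⟩ := hβ _ (M.le_scalars hc) htop
  -- Some power of β of prime power order is still nonscalar, and it inherits the conjugation
  -- property.
  obtain ⟨m, q, k, hq, hm, hmZ⟩ : ∃ m q k : ℕ, q.Prime ∧ orderOf (β ^ m) = q ^ k ∧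
      β ^ m ∉ M.scalars := by
    by_contra! hall
    exact hβZ (Subgroup.mem_of_primary_powers_mem _ β hall)
  refine hmZ (exists_scalar_of_quadratic M.action (M.eq_bot_or_eq_top hmin) ?_ (β ^ m) hq
    (k := k) ?_ fun r => ?_)
  · intro g q k hq hg
    exact Module.End.exists_quadratic_of_forall _
      fun v => M.exists_action_sq_apply hG (Fact.out : p.Prime) hq hg v
  · rw [← map_pow, ← hm, pow_orderOf_eq_one, map_one]
  · obtain ⟨i, z, ⟨c, hcz⟩, h⟩ := hβr r
    refine ⟨i, c ^ m, fun v => ?_⟩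
    have h1 : r⁻¹ * β ^ m * r = (r⁻¹ * β * r) ^ m := by
      have := conj_pow (a := r⁻¹) (b := β) (i := m)
      rwa [inv_inv, eq_comm] at this
    have h2 : M.action (β ^ i * z) = c • M.action β ^ i := LinearMap.ext fun w => by
      rw [map_mul, Module.End.mul_apply, hcz, map_smul, map_pow, LinearMap.smul_apply]
    rw [h1, h, map_pow, h2, smul_pow, LinearMap.smul_apply, map_pow, ← pow_mul, ← pow_mul, mul_comm]

end ConjugationModule

/-! ### Supersoluble series and the induction -/

theorem isCyclic_iff_exists_of_map {G : Type*} [Group G] (K : Subgroup G) [K.Normal]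
    (L : Subgroup G) :
    IsCyclic (L.map (QuotientGroup.mk' K)) ↔
      ∃ β ∈ L, ∀ x ∈ L, ∃ i : ℤ, ∃ z ∈ K, x = β ^ i * z := by
  rw [Subgroup.isCyclic_iff_exists_zpowers_eq_top]
  constructor
  · rintro ⟨g, hg⟩
    obtain ⟨β, hβ, rfl⟩ : g ∈ L.map (QuotientGroup.mk' K) := hg ▸ Subgroup.mem_zpowers g
    refine ⟨β, hβ, fun x hx => ?_⟩
    have h1 : QuotientGroup.mk' K x ∈ Subgroup.zpowers (QuotientGroup.mk' K β) :=
      hg ▸ Subgroup.mem_map_of_mem _ hx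
    obtain ⟨i, hi⟩ := h1
    refine ⟨i, (β ^ i)⁻¹ * x, ?_, by group⟩
    rw [← QuotientGroup.eq, ← QuotientGroup.mk'_apply, ← QuotientGroup.mk'_apply, ← hi, map_zpow]
  · rintro ⟨β, hβ, h⟩
    refine ⟨QuotientGroup.mk' K β, le_antisymm ?_ ?_⟩
    · rw [Subgroup.zpowers_le]
      exact Subgroup.mem_map_of_mem _ hβ
    · rintro _ ⟨x, hx, rfl⟩
      obtain ⟨i, z, hz, rfl⟩ := h x hx
      refine ⟨i, ?_⟩
      have : QuotientGroup.mk' K z = 1 := (QuotientGroup.eq_one_iff z).2 hz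
      rw [map_mul, this, mul_one, map_zpow]

/-- In an extension of `N` with supersoluble quotient, every proper subgroup above `N` misses some
element generating a normal subgroup modulo it. -/
theorem FiniteGroup.IsSupersoluble.exists_conj_eq {G : Type*} [Group G] [Finite G]
    {N : Subgroup G} [N.Normal] (h : FiniteGroup.IsSupersoluble (G ⧸ N)) (Z : Subgroup G)
    (hNZ : N ≤ Z) (hZ : Z ≠ ⊤) :
    ∃ β ∉ Z, ∀ r : G, ∃ i : ℕ, ∃ z ∈ Z, r⁻¹ * β * r = β ^ i * z := by
  obtain ⟨n, S, hS, h0, hn, hstep⟩ := h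
  let π := QuotientGroup.mk' N
  -- At the step where the series first leaves Z, a generator β of the factor works: its conjugates
  -- stay in the next term, and the current term lies in Z.
  obtain ⟨i, hi, hle⟩ : ∃ i < n, (S i).comap π ≤ Z ∧ ¬ (S (i + 1)).comap π ≤ Z := by
    by_contra! hall
    have : ∀ i ≤ n, (S i).comap π ≤ Z := by
      intro i
      induction i with
      | zero =>
        intro _
        rwa [h0, MonoidHom.comap_bot, QuotientGroup.ker_mk']
      | succ i ih => exact fun hi => hall i hi (ih (by omega))
    have := this n le_rfl
    rw [hn, Subgroup.comap_top, top_le_iff] at this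
    exact hZ this
  obtain ⟨b, hb, hgen⟩ := (isCyclic_iff_exists_of_map _ _).1 (hstep i hi).2
  obtain ⟨β, rfl⟩ := QuotientGroup.mk'_surjective N b
  have hgen' : ∀ x : G, π x ∈ S (i + 1) → ∃ j : ℕ, ∃ z ∈ Z, x = β ^ j * z := by
    intro x hx
    obtain ⟨j, z, hz, hxz⟩ := hgen _ hx
    obtain ⟨m, hm⟩ : β ^ j ∈ Submonoid.powers β := mem_powers_iff_mem_zpowers.2 ⟨j, rfl⟩
    refine ⟨m, (β ^ j)⁻¹ * x, hle.1 (Subgroup.mem_comap.2 ?_), by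
      simp only at hm; rw [hm]; group⟩
    rw [map_mul, map_inv, map_zpow, hxz, inv_mul_cancel_left]
    exact hz
  refine ⟨β, fun hβ => hle.2 fun x hx => ?_, fun r => hgen' _ ?_⟩
  · obtain ⟨j, z, hz, rfl⟩ := hgen' x hx
    exact mul_mem (pow_mem hβ j) hz
  · have := (hS (i + 1)).conj_mem _ hb (π r⁻¹)
    rwa [← map_inv, inv_inv, ← map_mul, ← map_mul] at this

theorem FiniteGroup.isSupersoluble_of_quotient {G : Type*} [Group G]
    {N : Subgroup G} [N.Normal] (h : FiniteGroup.IsSupersoluble (G ⧸ N))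
    (hN : ∃ a ∈ N, ∀ x ∈ N, x ∈ Subgroup.zpowers a) : FiniteGroup.IsSupersoluble G := by
  obtain ⟨n, S, hS, h0, hn, hstep⟩ := h
  let π := QuotientGroup.mk' N
  -- The new series is the preimage of the old one, shifted by one, with ⊥ put in front; its first
  -- factor is N.
  have hT : ∀ i, (Nat.rec ⊥ (fun i _ => (S i).comap π) i : Subgroup G).Normal := by
    intro i
    cases i with
    | zero => exact Subgroup.normal_bot
    | succ i => exact (hS i).comap π
  refine ⟨n + 1, fun i => Nat.rec ⊥ (fun i _ => (S i).comap π) i, hT, rfl, ?_, fun i hi => ?_⟩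
  · change (S n).comap π = ⊤
    rw [hn, Subgroup.comap_top]
  · refine ⟨?_, (isCyclic_iff_exists_of_map _ _).2 ?_⟩
    · cases i with
      | zero => exact bot_le
      | succ i => exact Subgroup.comap_mono (hstep i (by omega)).1
    · cases i with
      | zero =>
        obtain ⟨a, ha, hgen⟩ := hN
        change ∃ β ∈ (S 0).comap π, ∀ x ∈ (S 0).comap π, ∃ i : ℤ, ∃ z ∈ (⊥ : Subgroup G),
          x = β ^ i * z
        rw [h0, MonoidHom.comap_bot, QuotientGroup.ker_mk']
        refine ⟨a, ha, fun x hx => ?_⟩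
        obtain ⟨j, rfl⟩ := hgen x hx
        exact ⟨j, 1, one_mem _, (mul_one _).symm⟩
      | succ i =>
        obtain ⟨b, hb, hgen⟩ := (isCyclic_iff_exists_of_map _ _).1 (hstep i (by omega)).2
        obtain ⟨β, rfl⟩ := QuotientGroup.mk'_surjective N b
        refine ⟨β, hb, fun x hx => ?_⟩
        obtain ⟨j, z, hz, hxz⟩ := hgen _ hx
        refine ⟨j, (β ^ j)⁻¹ * x, ?_, by group⟩
        change π ((β ^ j)⁻¹ * x) ∈ S i
        rw [map_mul, map_inv, map_zpow, hxz, inv_mul_cancel_left]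
        exact hz

/-- A nontrivial normal `p`-subgroup contains a minimal normal subgroup of `G`, and that is
elementary abelian. -/
theorem Subgroup.exists_minimal_normal_elementary {G : Type*} [Group G] [Finite G] {p : ℕ}
    [hp : Fact p.Prime] {P : Subgroup G} (hP : P.Normal) (hPp : IsPGroup p P) (hP1 : P ≠ ⊥) :
    ∃ N : Subgroup G, N.Normal ∧ N ≠ ⊥ ∧ (∀ x ∈ N, ∀ y ∈ N, x * y = y * x) ∧
      (∀ x ∈ N, x ^ p = 1) ∧ ∀ L : Subgroup G, L.Normal → L ≤ N → L = ⊥ ∨ L = N := by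
  -- The elements of the centre of P with p-th power 1: normal in G, and nontrivial because a
  -- nontrivial p-group has a nontrivial centre.
  let E : Subgroup G :=
    { carrier := {x | x ∈ P ∧ x ^ p = 1 ∧ ∀ y ∈ P, Commute x y}
      one_mem' := ⟨P.one_mem, one_pow p, fun y _ => Commute.one_left y⟩
      mul_mem' := fun {a b} ha hb => ⟨P.mul_mem ha.1 hb.1, by
        rw [(ha.2.2 b hb.1).mul_pow, ha.2.1, hb.2.1, one_mul],
        fun y hy => (ha.2.2 y hy).mul_left (hb.2.2 y hy)⟩
      inv_mem' := fun {a} ha => ⟨P.inv_mem ha.1, by rw [inv_pow, ha.2.1, inv_one],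
        fun y hy => (ha.2.2 y hy).inv_left⟩ }
  have hEn : E.Normal := by
    refine ⟨fun x hx g => ⟨hP.conj_mem x hx.1 g, by rw [conj_pow, hx.2.1]; group, fun y hy => ?_⟩⟩
    have h := hx.2.2 _ (hP.conj_mem y hy g⁻¹)
    have h' := h.map (MulAut.conj g).toMonoidHom
    simpa [mul_assoc] using h'
  have hE1 : E ≠ ⊥ := by
    have : Nontrivial P := (Subgroup.nontrivial_iff_ne_bot P).2 hP1
    have := hPp.center_nontrivial
    obtain ⟨k, hk, hcard⟩ := (hPp.to_subgroup (Subgroup.center P)).nontrivial_iff_card.1 this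
    obtain ⟨x, hx⟩ := exists_prime_orderOf_dvd_card' (G := Subgroup.center P) p
      (hcard ▸ dvd_pow_self p hk.ne')
    intro h
    have hxE : ((x : P) : G) ∈ E := by
      refine ⟨(x : P).2, ?_, fun y hy => ?_⟩
      · have := pow_orderOf_eq_one x
        rw [hx] at this
        exact congrArg (fun u : Subgroup.center P => ((u : P) : G)) this
      · exact congrArg Subtype.val (Subgroup.mem_center_iff.1 x.2 ⟨y, hy⟩).symm
    rw [h, Subgroup.mem_bot] at hxE
    have : x = 1 := Subtype.ext (Subtype.ext hxE)
    rw [this, orderOf_one] at hx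
    exact hp.1.one_lt.ne hx
  obtain ⟨N, hNE, ⟨hN, hN1⟩, hmin⟩ :=
    exists_minimal_le_of_wellFoundedLT (fun L : Subgroup G => L.Normal ∧ L ≠ ⊥) E ⟨hEn, hE1⟩
  refine ⟨N, hN, hN1, fun x hx y hy => (hNE hx).2.2 y (hNE hy).1, fun x hx => (hNE hx).2.1,
    fun L hL hLN => or_iff_not_imp_left.2 fun hL1 => le_antisymm hLN (hmin ⟨hL, hL1⟩ hLN)⟩

theorem HasPermutablePrimaryElements.isSupersoluble {G : Type u} [Group G] [Finite G]
    (hG : HasPermutablePrimaryElements G) : FiniteGroup.IsSupersoluble G := by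
  induction hn : Nat.card G using Nat.strong_induction_on generalizing G with
  | h n ih =>
    subst hn
    by_cases hcard : Nat.card G = 1
    · have := (Nat.card_eq_one_iff_unique.1 hcard).1
      exact ⟨0, fun _ => ⊥, fun _ => inferInstance, rfl, Subsingleton.elim _ _,
        fun i hi => absurd hi (Nat.not_lt_zero i)⟩
    have hne : (Nat.card G).primeFactors.Nonempty :=
      Nat.nonempty_primeFactors.2 (by have := Nat.card_pos (α := G); omega)
    obtain ⟨p, hpmem, hpmax⟩ := (Nat.card G).primeFactors.exists_max_image (fun q => q) hne
    have hp : Fact p.Prime := ⟨Nat.prime_of_mem_primeFactors hpmem⟩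
    obtain ⟨P⟩ := (inferInstance : Nonempty (Sylow p G))
    have hPn := hG.sylow_normal
      (fun q hq hqG => hpmax q (Nat.mem_primeFactors.2 ⟨hq, hqG, Nat.card_pos.ne'⟩)) P
    obtain ⟨N, hN, hN1, hc, hNp, hmin⟩ := Subgroup.exists_minimal_normal_elementary hPn P.2
      (P.ne_bot_of_dvd_card (Nat.dvd_of_mem_primeFactors hpmem))
    have hlt : Nat.card (G ⧸ N) < Nat.card G := by
      rw [Subgroup.card_eq_card_quotient_mul_card_subgroup N]
      exact lt_mul_of_one_lt_right Nat.card_pos ((Subgroup.one_lt_card_iff_ne_bot N).2 hN1)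
    have hQ := ih _ hlt (hG.of_surjective (QuotientGroup.mk'_surjective N)) rfl
    obtain ⟨V, _, _, ⟨M⟩⟩ := ConjugationModule.exists_of_elementary N hc hNp
    exact FiniteGroup.isSupersoluble_of_quotient hQ
      (M.isCyclic_of_scalars_eq_top hmin (M.scalars_eq_top hG hc hmin hQ.exists_conj_eq))

theorem theorem4p1 {G : Type*} [Group G] [Finite G]
    (h : ∀ H : Subgroup G,
      FiniteGroup.IsPrimaryCyclic H → FiniteGroup.IsStronglyPermutable H) :
    FiniteGroup.IsSupersoluble G :=
  (hasPermutablePrimaryElements_of_isStronglyPermutable h).isSupersoluble
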